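/- Let $l>0$, $\alpha>-\tfrac12$, and let $n\ge 0$, $q\ge 1$ be integers. Let $G^{(\alpha)}_m$ denote the Gegenbauer polynomials on $[-1,1]$ normalized by $G^{(\alpha)}_m(1)=1$, that is, $G_0^{(\alpha)}=1$, $G_1^{(\alpha)}(x)=x$ and $(j+2\alpha)G^{(\alpha)}_{j+1}=2(j+\alpha)xG^{(\alpha)}_j-jG^{(\alpha)}_{j-1}$ for $j\ge1$, and let $x_0<x_1<\dots<x_n$ be the zeros of the shifted polynomial $G^{(\alpha)}_{n+1}(2x/l-1)$ (the shifted Gegenbauer--Gauss nodes on $[0,l]$). Put $z_j=2x_j/l-1$, let $\mathcal L_j$ be the Lagrange interpolating polynomials of the nodes $z_0,\dots,z_n$, and define the $q$-th order barycentric Gegenbauer integration matrix and its shifted version by $$p^{(q)}_{ij}=\frac{(z_i-z_j)^{q-1}}{(q-1)!}\int_{-1}^{z_i}\mathcal L_j(t)\,dt,\qquad {}_lp^{(q)}_{ij}=\Big(\frac l2\Big)^q p^{(q)}_{ij},\qquad 0\le i,j\le n .$$ Let $f\in C^{n+1}[0,l]$ satisfy $\|f^{(k)}\|_{L^\infty[0,l]}\le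 A_{\max}$ for all $k=0,\dots,n+1$, where $A_{\max}>0$. Let $$E_i=\int_0^{x_i}\int_0^{\sigma_{q-1}}\cdots\int_0^{\sigma_1}f(\sigma_0)\,d\sigma_0\cdots d\sigma_{q-1}-\sum_{j=0}^n{}_lp^{(q)}_{ij}f(x_j)$$ be the truncation error at $x_i$ of the $q$-th order barycentric shifted Gegenbauer quadrature (BSGQ). Then there exist numbers $\zeta_0,\dots,\zeta_n\in(0,l)$ such that, for every $i=0,\dots,n$, $$|E_i|\le\frac{2^{-n}A_{\max}\,l^{\,n+1}\,n_{\max,i}\,x_i\,\Gamma(1+\alpha)\,\Gamma(1+n+2\alpha)}{(n+1)!\,(q-1)!\,\Gamma(1+n+\alpha)\,\Gamma(1+2\alpha)}\;\vartheta_n^{(\alpha)},$$ where $$\vartheta_n^{(\alpha)}=\begin{cases}1,&\alpha\ge0,\\[4pt] \dfrac{2|\alpha|\,\Big|\dbinom{n/2+\alpha}{n/2}\Big|\,(n+1)!\,|\Gamma(2\alpha)|}{\sqrt{(1+n)(1+n+2\alpha)}\,\Gamma(1+n+2\alpha)},&-\tfrac12<\alpha<0,\ n\text{ even},\\[12pt]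 \dfrac{\Big|\dbinom{(n-1)/2+\alpha}{(n+1)/2}\Big|\,(n+1)!\,|\Gamma(2\alpha)|}{\Gamma(1+n+2\alpha)},&-\tfrac12<\alpha<0,\ n\text{ odd},\end{cases}$$ $$n_{\max,i}=\max\Big\{(q-1)!,\ \sup_{0\le k\le n+1}(q-1)_{n-k+1}\,|x_i-\zeta_i|^{\,q-n+k-2}\Big\}.$$ Here $\binom{a}{m}=a(a-1)\cdots(a-m+1)/m!$ is the generalized binomial coefficient, $(a)_m=a(a-1)\cdots(a-m+1)$ is the falling factorial, and terms of the supremum with $n-k+1>q-1$ (whose falling factorial vanishes) count as $0$. -/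

import Mathlib

open Polynomial

noncomputable section

/-- The Gegenbauer polynomials on `[-1, 1]` in the normalization `G_n^{(α)}(1) = 1` (so that `α = 0`
gives the Chebyshev polynomials of the first kind, `α = 1/2` the Legendre polynomials):
`G_0 = 1`, `G_1 = x`, `(j + 2α) G_{j+1} = 2 (j + α) x G_j - j G_{j-1}` for `j ≥ 1`. -/
def gegenbauer (α : ℝ) : ℕ → ℝ[X]
  | 0 => 1
  | 1 => X
  | (j + 2) =>
      C (2 * (((j : ℝ) + 1) + α) / (((j : ℝ) + 1) + 2 * α)) * X * gegenbauer α (j + 1)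
        - C (((j : ℝ) + 1) / (((j : ℝ) + 1) + 2 * α)) * gegenbauer α j

/-- The shifted Gegenbauer polynomials on `[0, l]`: `G_{l,n}^{(α)}(x) = G_n^{(α)}(2 x / l - 1)`. -/
def shiftedGegenbauer (l α : ℝ) (n : ℕ) : ℝ[X] :=
  (gegenbauer α n).comp (C (2 / l) * X - 1)

/-- `x 0 < x 1 < ⋯ < x n` are exactly the zeros of the shifted Gegenbauer polynomial of
degree `n + 1`: the shifted Gegenbauer–Gauss nodes on `[0, l]`, sorted ascendingly. -/
def IsSGGNodes (l α : ℝ) (n : ℕ) (x : Fin (n + 1) → ℝ) : Prop :=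
  StrictMono x ∧ Set.range x = {t : ℝ | (shiftedGegenbauer l α (n + 1)).IsRoot t}

/-- The `q`-fold integral
`∫_0^{t} ∫_0^{σ_{q-1}} ⋯ ∫_0^{σ_1} f(σ_0) dσ_0 ⋯ dσ_{q-1}` (and `f t` for `q = 0`). -/
def foldIntegral (f : ℝ → ℝ) : ℕ → ℝ → ℝ
  | 0, t => f t
  | (q + 1), t => ∫ σ in (0 : ℝ)..t, foldIntegral f q σ

/-- The fundamental Lagrange interpolating polynomial of the nodes `z`, i.e. the polynomial of
degree `n` with value `δ_{jk}` at `z k`. See `lagrangeBasis_eq_barycentric` for its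
barycentric representation. -/
def lagrangeBasis {n : ℕ} (z : Fin (n + 1) → ℝ) (j : Fin (n + 1)) : ℝ[X] :=
  Lagrange.basis Finset.univ z j

/-- Away from the nodes, the Lagrange polynomials are given by the barycentric formula
`(w_j / (y - z_j)) / ∑_k w_k / (y - z_k)` with barycentric weights `w_k`. -/
theorem lagrangeBasis_eq_barycentric {n : ℕ} {z : Fin (n + 1) → ℝ} (hz : StrictMono z)
    (j : Fin (n + 1)) {y : ℝ} (hy : ∀ k, y ≠ z k) :
    (lagrangeBasis z j).eval y =
      (Lagrange.nodalWeight Finset.univ z j / (y - z j)) /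
        ∑ k, Lagrange.nodalWeight Finset.univ z k / (y - z k) := by
  have hinj : Set.InjOn z (Finset.univ : Finset (Fin (n + 1))) := hz.injective.injOn
  have hne : (Finset.univ : Finset (Fin (n + 1))).Nonempty := ⟨0, Finset.mem_univ _⟩
  have h0 := Lagrange.sum_nodalWeight_mul_inv_sub_ne_zero hinj (fun i _ => hy i) hne
  have hs := congrArg (Polynomial.eval y) (Lagrange.sum_basis hinj hne)
  rw [Polynomial.eval_finsetSum] at hs
  simp only [Lagrange.eval_basis_not_at_node (Finset.mem_univ _) (hy _), Polynomial.eval_one] at hs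
  rw [← Finset.mul_sum] at hs
  rw [lagrangeBasis, Lagrange.eval_basis_not_at_node (Finset.mem_univ _) (hy _)]
  simp only [div_eq_mul_inv] at h0 hs ⊢
  rw [eq_mul_inv_iff_mul_eq₀ h0]
  linear_combination (Lagrange.nodalWeight Finset.univ z j * (y - z j)⁻¹) * hs

/-- The `q`-th order barycentric Gegenbauer integration matrix on `[-1, 1]`, `q ≥ 1`, at nodes `z`:
the first-order entries are `∫_{-1}^{z_i}` of the `j`-th Lagrange polynomial, and the `q`-th order
entries are obtained from these through the factor `(z_i - z_j)^{q-1} / (q-1)!`. -/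
def gim {n : ℕ} (z : Fin (n + 1) → ℝ) (q : ℕ) : Matrix (Fin (n + 1)) (Fin (n + 1)) ℝ :=
  Matrix.of fun i j =>
    (z i - z j) ^ (q - 1) / ((q - 1).factorial : ℝ) *
      ∫ t in (-1 : ℝ)..(z i), (lagrangeBasis z j).eval t

/-- The `q`-th order barycentric shifted Gegenbauer integration matrix at the nodes `x` in `[0, l]`:
`(l/2)^q` times the matrix of order `q` at the corresponding nodes `2 x_j / l - 1` in `[-1, 1]`. -/
def bsgim (l : ℝ) {n : ℕ} (x : Fin (n + 1) → ℝ) (q : ℕ) :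
    Matrix (Fin (n + 1)) (Fin (n + 1)) ℝ :=
  (l / 2) ^ q • gim (fun j => 2 * x j / l - 1) q

/-- The truncation error of the `q`-th order barycentric shifted Gegenbauer quadrature at `x i`:
the `q`-fold integral of `f` up to `x i` minus the `i`-th row of the integration matrix times
the vector of the values of `f` at the nodes. -/
def bsgqError (l : ℝ) {n : ℕ} (x : Fin (n + 1) → ℝ) (q : ℕ) (f : ℝ → ℝ) (i : Fin (n + 1)) : ℝ :=
  foldIntegral f q (x i) - (bsgim l x q).mulVec (fun j => f (x j)) i

/-- `n_max = max {(q-1)!, sup_{0 ≤ k ≤ n+1} (q-1)_{n-k+1} |x - ζ|^{q-n+k-2}}`, where `(a)_m` is the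
falling factorial `a (a-1) ⋯ (a-m+1)`; the exponent is an integer, and a term with a negative
exponent vanishes because its falling factorial does. -/
def nMax (n q : ℕ) (x ζ : ℝ) : ℝ :=
  max ((q - 1).factorial : ℝ)
    (⨆ k : Fin (n + 2), (descPochhammer ℝ (n + 1 - (k : ℕ))).eval ((q : ℝ) - 1) *
      |x - ζ| ^ ((q : ℤ) - (n : ℤ) + ((k : ℕ) : ℤ) - 2))

/-- The factor that distinguishes `α ≥ 0`, `-1/2 < α < 0` with `n` even, and `-1/2 < α < 0` with `n`
odd. `Ring.choose` is the generalized binomial coefficient `a (a-1) ⋯ (a-m+1) / m!`. -/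
def caseFactor (α : ℝ) (n : ℕ) : ℝ :=
  if 0 ≤ α then 1
  else if Even n then
    2 * |α| * |Ring.choose ((n : ℝ) / 2 + α) (n / 2)| * ((n + 1).factorial : ℝ)
        * |Real.Gamma (2 * α)|
      / (Real.sqrt ((1 + (n : ℝ)) * (1 + (n : ℝ) + 2 * α)) * Real.Gamma (1 + (n : ℝ) + 2 * α))
  else
    |Ring.choose (((n : ℝ) - 1) / 2 + α) ((n + 1) / 2)| * ((n + 1).factorial : ℝ)
        * |Real.Gamma (2 * α)|
      / Real.Gamma (1 + (n : ℝ) + 2 * α)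

end

/-! Write `g s = (x i - s) ^ (q - 1) * f s`. Cauchy's formula for repeated integration turns the
`q`-fold integral into `1 / (q - 1)!` times the integral of `g` over `[0, x i]`, and the factor `(x
i - x j) ^ (q - 1)` in the matrix makes the quadrature the same multiple of the integral of the
Lagrange interpolant of `g` (`bsgqError_eq_integral`). The mean value theorem replaces the integral
of the difference by `x i` times its value at some `τ`, and the interpolation error formula
(`exists_sub_interpolate_eq`) makes that value `g^(n+1)(ζ) / (n+1)!` times the nodal polynomial at
`τ`.

Two estimates remain. Leibniz' rule bounds `g^(n+1)(ζ)` by `2 ^ (n + 1) * Amax * nMax`, the binomial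
coefficients summing to `2 ^ (n + 1)`. The nodal polynomial is the shifted Gegenbauer polynomial
over its leading coefficient, so it suffices to bound `|G_{n+1}|` on `[-1, 1]` by `caseFactor`. That
is Sonin's argument: `u ^ 2 + (1 - x ^ 2) / N * u' ^ 2` dominates `u ^ 2` and is monotone on `[0,
1]`, increasing for `α ≥ 0` (maximum at `1`) and decreasing for `α < 0` (maximum at `0`). -/

/-! ### Gegenbauer polynomials: recurrence, differential equation, location of zeros. -/

theorem gegenbauer_recurrence {α : ℝ} (hα : -(1 / 2 : ℝ) < α) (m : ℕ) :
    C ((m : ℝ) + 1 + 2 * α) * gegenbauer α (m + 2) =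
      C (2 * ((m : ℝ) + 1 + α)) * X * gegenbauer α (m + 1)
        - C ((m : ℝ) + 1) * gegenbauer α m := by
  have h : (m : ℝ) + 1 + 2 * α ≠ 0 := by
    have : (0 : ℝ) ≤ m := m.cast_nonneg
    linarith
  rw [gegenbauer, mul_sub, ← mul_assoc, ← mul_assoc, ← mul_assoc, ← C_mul, ← C_mul,
    mul_div_cancel₀ _ h, mul_div_cancel₀ _ h]

theorem gegenbauer_recurrence_eval {α : ℝ} (hα : -(1 / 2 : ℝ) < α) (m : ℕ) (x : ℝ) :
    ((m : ℝ) + 1 + 2 * α) * (gegenbauer α (m + 2)).eval x =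
      2 * ((m : ℝ) + 1 + α) * x * (gegenbauer α (m + 1)).eval x
        - ((m : ℝ) + 1) * (gegenbauer α m).eval x := by
  simpa only [eval_mul, eval_sub, eval_C, eval_X] using
    congrArg (Polynomial.eval x) (gegenbauer_recurrence hα m)

/-- The induction needs both identities: differentiating the recurrence brings in the derivatives of
two consecutive polynomials. The second identity then follows from the first and the recurrence. -/
theorem gegenbauer_derivative_lower_and_raise {α : ℝ} (hα : -(1 / 2 : ℝ) < α) (m : ℕ) :
    (1 - X ^ 2) * derivative (gegenbauer α (m + 1)) =
        C ((m : ℝ) + 1) * (gegenbauer α m - X * gegenbauer α (m + 1)) ∧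
      (1 - X ^ 2) * derivative (gegenbauer α m) =
        C ((m : ℝ) + 2 * α) * (X * gegenbauer α m - gegenbauer α (m + 1)) := by
  induction m with
  | zero => constructor <;> (simp [gegenbauer]; try ring)
  | succ m ih =>
    obtain ⟨hA, hB⟩ := ih
    have hr := gegenbauer_recurrence hα m
    have hd := congrArg derivative hr
    have h : (m : ℝ) + 1 + 2 * α ≠ 0 := by
      have : (0 : ℝ) ≤ m := m.cast_nonneg
      linarith
    constructor
    · apply mul_left_cancel₀ (C_ne_zero.mpr h)
      simp only [derivative_mul, derivative_sub, derivative_C, derivative_X, zero_mul, zero_add,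
        derivative_add, derivative_one, add_zero, Nat.cast_add, Nat.cast_one, C_add, C_mul, C_1, mul_one, add_assoc, Nat.reduceAdd] at *
      have h2 : (C (2 : ℝ) : ℝ[X]) = 2 := rfl
      simp only [h2] at *
      linear_combination (1 - X ^ 2) * hd + 2 * (C (m : ℝ) + 1 + C α) * X * hA
        - (C (m : ℝ) + 1) * hB + (C (m : ℝ) + 2) * X * hr
    · simp only [Nat.cast_add, Nat.cast_one, C_add, C_mul, C_1] at *
      have h2 : (C (2 : ℝ) : ℝ[X]) = 2 := rfl
      simp only [h2] at *
      linear_combination hA + hr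

theorem gegenbauer_derivative_lower {α : ℝ} (hα : -(1 / 2 : ℝ) < α) (m : ℕ) :
    (1 - X ^ 2) * derivative (gegenbauer α (m + 1)) =
      C ((m : ℝ) + 1) * (gegenbauer α m - X * gegenbauer α (m + 1)) :=
  (gegenbauer_derivative_lower_and_raise hα m).1

/-- The differential equation of the Gegenbauer polynomials. -/
theorem gegenbauer_ode {α : ℝ} (hα : -(1 / 2 : ℝ) < α) (m : ℕ) :
    (1 - X ^ 2) * derivative (derivative (gegenbauer α (m + 1)))
      - C (1 + 2 * α) * X * derivative (gegenbauer α (m + 1))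
      + C (((m : ℝ) + 1) * ((m : ℝ) + 1 + 2 * α)) * gegenbauer α (m + 1) = 0 := by
  obtain ⟨hA, hB⟩ := gegenbauer_derivative_lower_and_raise hα m
  have hd := congrArg derivative hA
  have h : (1 - X ^ 2 : ℝ[X]) ≠ 0 := fun h0 => by
    have := congrArg (Polynomial.eval 0) h0
    simp at this
  -- One more factor `1 - X ^ 2` lets both first-order identities eliminate the lower-degree
  -- polynomial and its derivative.
  apply mul_left_cancel₀ h
  have h2 : (C (2 : ℝ) : ℝ[X]) = 2 := rfl
  simp only [derivative_mul, derivative_sub, derivative_C, derivative_X, zero_mul, zero_add,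
    derivative_add, add_zero, derivative_one, derivative_X_pow, Nat.cast_ofNat, Nat.add_one_sub_one, pow_one,
    C_add, C_mul, C_1, h2, one_mul] at *
  linear_combination (1 - X ^ 2) * hd + (C (m : ℝ) + 1) * hB
    + X * (1 - 2 * C α - (C (m : ℝ) + 1)) * hA

theorem gegenbauer_eval_neg (α : ℝ) (m : ℕ) (x : ℝ) :
    (gegenbauer α m).eval (-x) = (-1) ^ m * (gegenbauer α m).eval x := by
  induction m using Nat.twoStepInduction with
  | zero => simp [gegenbauer]
  | one => simp [gegenbauer]
  | more m h0 h1 =>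
    simp only [gegenbauer, eval_sub, eval_mul, eval_C, eval_X, h0, h1]
    ring

theorem abs_gegenbauer_eval_abs (α : ℝ) (m : ℕ) (x : ℝ) :
    |(gegenbauer α m).eval (|x|)| = |(gegenbauer α m).eval x| := by
  rcases abs_choice x with h | h
  · rw [h]
  · rw [h, gegenbauer_eval_neg, abs_mul, abs_pow, abs_neg, abs_one, one_pow, one_mul]

theorem gegenbauer_eval_one {α : ℝ} (hα : -(1 / 2 : ℝ) < α) (m : ℕ) :
    (gegenbauer α m).eval 1 = 1 := by
  induction m using Nat.twoStepInduction with
  | zero => simp [gegenbauer]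
  | one => simp [gegenbauer]
  | more m h0 h1 =>
    have h : (m : ℝ) + 1 + 2 * α ≠ 0 := by
      have : (0 : ℝ) ≤ m := m.cast_nonneg
      linarith
    have hr := gegenbauer_recurrence_eval hα m 1
    rw [h0, h1] at hr
    apply mul_left_cancel₀ h
    linear_combination hr

/-- In the recurrence the coefficients satisfy `2 (m + 1 + α) - (m + 1) = m + 1 + 2 α`, so
monotonicity in the degree propagates. With parity, this confines all zeros to `(-1, 1)` without
using orthogonality. -/
theorem one_le_gegenbauer_eval {α : ℝ} (hα : -(1 / 2 : ℝ) < α) {x : ℝ} (hx : 1 ≤ x) (m : ℕ) :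
    1 ≤ (gegenbauer α m).eval x ∧
      (gegenbauer α m).eval x ≤ (gegenbauer α (m + 1)).eval x := by
  induction m with
  | zero => simpa [gegenbauer] using hx
  | succ m ih =>
    obtain ⟨h1, h2⟩ := ih
    refine ⟨h1.trans h2, ?_⟩
    have hm : (0 : ℝ) ≤ m := m.cast_nonneg
    have h : 0 < (m : ℝ) + 1 + 2 * α := by linarith
    have hr := gegenbauer_recurrence_eval hα m x
    have h3 : (gegenbauer α (m + 1)).eval x ≤ x * (gegenbauer α (m + 1)).eval x :=
      le_mul_of_one_le_left (by linarith) hx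
    have h4 := mul_le_mul_of_nonneg_left h3 (by linarith : 0 ≤ 2 * ((m : ℝ) + 1 + α))
    have h5 := mul_le_mul_of_nonneg_left h2 (by linarith : 0 ≤ (m : ℝ) + 1)
    refine le_of_mul_le_mul_left ?_ h
    linarith

theorem abs_lt_one_of_gegenbauer_isRoot {α : ℝ} (hα : -(1 / 2 : ℝ) < α) {m : ℕ} {x : ℝ}
    (hx : (gegenbauer α m).IsRoot x) : |x| < 1 := by
  by_contra! h
  have h1 := (one_le_gegenbauer_eval hα h m).1
  have h2 := abs_gegenbauer_eval_abs α m x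
  rw [hx.eq_zero, abs_zero, abs_eq_zero] at h2
  linarith

/-! ### Uniform bounds on `[-1, 1]` by Sonin's method. -/

/-- Sonin's function `u ^ 2 + (1 - x ^ 2) / N * u' ^ 2` of the Gegenbauer polynomial `u` of degree
`m + 1`, where `N = (m + 1) * (m + 1 + 2 * α)`. -/
noncomputable def soninFunction (α : ℝ) (m : ℕ) (x : ℝ) : ℝ :=
  (gegenbauer α (m + 1)).eval x ^ 2 +
    (1 - x ^ 2) / (((m : ℝ) + 1) * ((m : ℝ) + 1 + 2 * α)) *
      (derivative (gegenbauer α (m + 1))).eval x ^ 2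

/-- The differential equation eliminates `u''`, and the terms in `u * u'` cancel. The remaining
derivative has the sign of `α * x`. -/
theorem hasDerivAt_soninFunction {α : ℝ} (hα : -(1 / 2 : ℝ) < α) (m : ℕ) (x : ℝ) :
    HasDerivAt (soninFunction α m)
      (4 * α * x / (((m : ℝ) + 1) * ((m : ℝ) + 1 + 2 * α)) *
        (derivative (gegenbauer α (m + 1))).eval x ^ 2) x := by
  have hm : (0 : ℝ) ≤ m := m.cast_nonneg
  have h1 : (m : ℝ) + 1 ≠ 0 := by linarith
  have h2 : (m : ℝ) + 1 + 2 * α ≠ 0 := by linarith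
  have hode := congrArg (Polynomial.eval x) (gegenbauer_ode hα m)
  simp only [eval_add, eval_sub, eval_mul, eval_one, eval_pow, eval_X, eval_C, eval_zero] at hode
  have hu := ((gegenbauer α (m + 1)).hasDerivAt x).fun_pow 2
  have hu' := ((derivative (gegenbauer α (m + 1))).hasDerivAt x).fun_pow 2
  have hw := (((hasDerivAt_id x).fun_pow 2).const_sub 1).div_const
    (((m : ℝ) + 1) * ((m : ℝ) + 1 + 2 * α))
  refine (hu.add (hw.mul hu')).congr_deriv ?_
  simp only [id]
  field_simp
  simp only [Nat.cast_ofNat, Nat.add_one_sub_one, pow_one]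
  linear_combination 2 * (derivative (gegenbauer α (m + 1))).eval x * hode

theorem sq_gegenbauer_eval_le_soninFunction {α : ℝ} (hα : -(1 / 2 : ℝ) < α) (m : ℕ) {x : ℝ}
    (hx : |x| ≤ 1) : (gegenbauer α (m + 1)).eval x ^ 2 ≤ soninFunction α m x := by
  have hm : (0 : ℝ) ≤ m := m.cast_nonneg
  have h2 : 0 < (m : ℝ) + 1 + 2 * α := by linarith
  have h3 : 0 ≤ 1 - x ^ 2 := by rw [← sq_abs]; nlinarith [abs_nonneg x]
  unfold soninFunction
  have : 0 ≤ (1 - x ^ 2) / (((m : ℝ) + 1) * ((m : ℝ) + 1 + 2 * α)) *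
      (derivative (gegenbauer α (m + 1))).eval x ^ 2 := by positivity
  linarith

theorem sq_gegenbauer_eval_le_one {α : ℝ} (hα : 0 ≤ α) (m : ℕ) {x : ℝ} (hx : |x| ≤ 1) :
    (gegenbauer α (m + 1)).eval x ^ 2 ≤ 1 := by
  have hα' : -(1 / 2 : ℝ) < α := by linarith
  have hmono : MonotoneOn (soninFunction α m) (Set.Icc 0 1) := by
    refine monotoneOn_of_deriv_nonneg (convex_Icc 0 1)
      (fun y _ => (hasDerivAt_soninFunction hα' m y).continuousAt.continuousWithinAt)
      (fun y _ => (hasDerivAt_soninFunction hα' m y).differentiableAt.differentiableWithinAt)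
      fun y hy => ?_
    rw [interior_Icc] at hy
    rw [(hasDerivAt_soninFunction hα' m y).deriv]
    have := hy.1
    positivity
  have h := hmono ⟨abs_nonneg x, hx⟩ (Set.right_mem_Icc.mpr zero_le_one) hx
  have h1 := sq_gegenbauer_eval_le_soninFunction hα' m (x := |x|) (by rwa [abs_abs])
  rw [← sq_abs, abs_gegenbauer_eval_abs, sq_abs] at h1
  simpa [soninFunction, gegenbauer_eval_one hα'] using h1.trans h

theorem sq_gegenbauer_eval_le_of_neg {α : ℝ} (hα : -(1 / 2 : ℝ) < α) (h0 : α < 0) (m : ℕ) {x : ℝ}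
    (hx : |x| ≤ 1) :
    (gegenbauer α (m + 1)).eval x ^ 2 ≤ (gegenbauer α (m + 1)).eval 0 ^ 2 +
      ((m : ℝ) + 1) / ((m : ℝ) + 1 + 2 * α) * (gegenbauer α m).eval 0 ^ 2 := by
  have hm : (0 : ℝ) ≤ m := m.cast_nonneg
  have h2 : 0 < (m : ℝ) + 1 + 2 * α := by linarith
  have hanti : AntitoneOn (soninFunction α m) (Set.Icc 0 1) := by
    refine antitoneOn_of_deriv_nonpos (convex_Icc 0 1)
      (fun y _ => (hasDerivAt_soninFunction hα m y).continuousAt.continuousWithinAt)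
      (fun y _ => (hasDerivAt_soninFunction hα m y).differentiableAt.differentiableWithinAt)
      fun y hy => ?_
    rw [interior_Icc] at hy
    rw [(hasDerivAt_soninFunction hα m y).deriv]
    refine mul_nonpos_of_nonpos_of_nonneg (div_nonpos_of_nonpos_of_nonneg ?_ (by positivity))
      (sq_nonneg _)
    nlinarith [hy.1]
  have h := hanti (Set.left_mem_Icc.mpr zero_le_one) ⟨abs_nonneg x, hx⟩ (abs_nonneg x)
  have h1 := sq_gegenbauer_eval_le_soninFunction hα m (x := |x|) (by rwa [abs_abs])
  rw [← sq_abs, abs_gegenbauer_eval_abs, sq_abs] at h1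
  refine (h1.trans h).trans_eq ?_
  -- At `0` the lowering identity reads `G_{m+1}'(0) = (m + 1) G_m(0)`.
  have hd := congrArg (Polynomial.eval 0) (gegenbauer_derivative_lower hα m)
  simp only [eval_sub, eval_mul, eval_one, eval_pow, eval_X, eval_C] at hd
  have hd' : (derivative (gegenbauer α (m + 1))).eval 0 =
      ((m : ℝ) + 1) * (gegenbauer α m).eval 0 := by linear_combination hd
  rw [soninFunction, hd']
  field_simp
  ring

/-! ### Values at the origin and the case factor. -/

theorem gegenbauer_odd_eval_zero (α : ℝ) (k : ℕ) : (gegenbauer α (2 * k + 1)).eval 0 = 0 := by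
  have h := gegenbauer_eval_neg α (2 * k + 1) 0
  rw [neg_zero, pow_succ, pow_mul] at h
  norm_num at h
  linarith

/-- The absorption identity, which advances the binomial coefficient in both inductions for the
values at `0`. -/
theorem Ring.choose_succ_mul_real (a : ℝ) (k : ℕ) :
    Ring.choose (a + 1) (k + 1) * (k + 1) = (a + 1) * Ring.choose a k := by
  have h1 : Ring.choose (a + 1) (k + 1) =
      ((k + 1).factorial : ℝ)⁻¹ * (descPochhammer ℝ (k + 1)).eval (a + 1) := by
    rw [Ring.choose_eq_smul, Polynomial.descPochhammer_smeval_eq_ascPochhammer,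
      ascPochhammer_smeval_eq_eval, descPochhammer_eval_eq_ascPochhammer, smul_eq_mul]
  have h2 : Ring.choose a k = ((k).factorial : ℝ)⁻¹ * (descPochhammer ℝ k).eval a := by
    rw [Ring.choose_eq_smul, Polynomial.descPochhammer_smeval_eq_ascPochhammer,
      ascPochhammer_smeval_eq_eval, descPochhammer_eval_eq_ascPochhammer, smul_eq_mul]
  rw [h1, h2, descPochhammer_succ_left, eval_mul, eval_comp]
  simp only [eval_X, eval_sub, eval_one, add_sub_cancel_right, Nat.factorial_succ, Nat.cast_mul,
    Nat.cast_add, Nat.cast_one]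
  have : (k.factorial : ℝ) ≠ 0 := by positivity
  field_simp

theorem two_mul_add_ne_zero {α : ℝ} (hα : -(1 / 2 : ℝ) < α) (h0 : α < 0) (k : ℕ) :
    2 * (k : ℝ) + 2 * α ≠ 0 := by
  rcases k with _ | k
  · simp [h0.ne]
  · have : (0 : ℝ) ≤ k := k.cast_nonneg
    push_cast
    linarith

/-- The values at `0` of the Gegenbauer polynomials of even degree, in terms of `binom(k+α, k)`. -/
theorem gegenbauer_even_eval_zero {α : ℝ} (hα : -(1 / 2 : ℝ) < α) (h0 : α < 0) (k : ℕ) :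
    (gegenbauer α (2 * k)).eval 0 * (2 * k + 1) * Real.Gamma (1 + 2 * (k : ℝ) + 2 * α) =
      (-1) ^ k * Ring.choose ((k : ℝ) + α) k * ((2 * k + 1).factorial : ℝ)
        * (2 * α * Real.Gamma (2 * α)) := by
  induction k with
  | zero =>
    simp [gegenbauer, ← Real.Gamma_add_one (mul_ne_zero two_ne_zero h0.ne), add_comm]
  | succ k ih =>
    have hk : (0 : ℝ) ≤ k := k.cast_nonneg
    have hr := gegenbauer_recurrence_eval hα (2 * k) 0
    have hch := Ring.choose_succ_mul_real ((k : ℝ) + α) k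
    have hG1 : Real.Gamma (1 + 2 * ((k + 1 : ℕ) : ℝ) + 2 * α) =
        (2 * k + 2 + 2 * α) * ((1 + 2 * k + 2 * α) * Real.Gamma (1 + 2 * (k : ℝ) + 2 * α)) := by
      rw [← Real.Gamma_add_one (by linarith : 1 + 2 * (k : ℝ) + 2 * α ≠ 0),
        show 2 * (k : ℝ) + 2 + 2 * α = 1 + 2 * k + 2 * α + 1 by ring,
        ← Real.Gamma_add_one (by linarith)]
      push_cast
      ring_nf
    rw [hG1, show 2 * (k + 1) = 2 * k + 2 by ring,
      show (2 * k + 2 + 1).factorial = (2 * k + 3) * ((2 * k + 2) * (2 * k + 1).factorial) by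
        rw [Nat.factorial_succ, Nat.factorial_succ],
      show ((k + 1 : ℕ) : ℝ) + α = (k + α) + 1 by push_cast; ring]
    push_cast at hr ⊢
    have hk1 : (k : ℝ) + 1 ≠ 0 := by linarith
    have hk2 : 2 * (k : ℝ) + 1 ≠ 0 := by linarith
    apply mul_left_cancel₀ hk1
    rw [pow_succ]
    generalize Ring.choose ((k : ℝ) + α + 1) (k + 1) = B at *
    generalize Ring.choose ((k : ℝ) + α) k = B' at *
    generalize Real.Gamma (1 + 2 * (k : ℝ) + 2 * α) = Γ' at *
    generalize Real.Gamma (2 * α) = Γ0 at *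
    generalize (gegenbauer α (2 * k + 2)).eval 0 = g2 at *
    generalize (gegenbauer α (2 * k)).eval 0 = g at *
    generalize ((2 * k + 1).factorial : ℝ) = F at *
    generalize (-1 : ℝ) ^ k = s at *
    have e : (2 * (k : ℝ) + 1 + 2 * α) * g2 = -((2 * k + 1) * g) := by linear_combination hr
    linear_combination (k + 1) * (2 * k + 3) * (2 * k + 2 + 2 * α) * Γ' * e
      - (k + 1) * (2 * k + 3) * (2 * k + 2 + 2 * α) * ih
      + s * (2 * k + 3) * (2 * k + 2) * F * (2 * α * Γ0) * hch

/-- A second closed form for the same values: with `2 * k = n + 1` it matches the binomial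
coefficient of the odd case, as the previous one with `2 * k = n` matches the even case. -/
theorem gegenbauer_even_succ_eval_zero {α : ℝ} (hα : -(1 / 2 : ℝ) < α) (h0 : α < 0) (k : ℕ) :
    (gegenbauer α (2 * k)).eval 0 * Real.Gamma (2 * (k : ℝ) + 2 * α) =
      (-1) ^ k * Ring.choose ((k : ℝ) + α - 1) k * ((2 * k).factorial : ℝ)
        * Real.Gamma (2 * α) := by
  induction k with
  | zero => simp [gegenbauer]
  | succ k ih =>
    have hk : (0 : ℝ) ≤ k := k.cast_nonneg
    have hr := gegenbauer_recurrence_eval hα (2 * k) 0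
    have hch := Ring.choose_succ_mul_real ((k : ℝ) + α - 1) k
    have hG1 : Real.Gamma (2 * ((k + 1 : ℕ) : ℝ) + 2 * α) =
        (2 * k + 1 + 2 * α) * ((2 * k + 2 * α) * Real.Gamma (2 * (k : ℝ) + 2 * α)) := by
      rw [← Real.Gamma_add_one (two_mul_add_ne_zero hα h0 k),
        show 2 * (k : ℝ) + 1 + 2 * α = 2 * k + 2 * α + 1 by ring,
        ← Real.Gamma_add_one (by linarith)]
      push_cast
      ring_nf
    rw [hG1, show 2 * (k + 1) = 2 * k + 2 by ring,
      show (2 * k + 2).factorial = (2 * k + 2) * ((2 * k + 1) * (2 * k).factorial) by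
        rw [Nat.factorial_succ, Nat.factorial_succ],
      show ((k + 1 : ℕ) : ℝ) + α - 1 = (k + α - 1) + 1 by push_cast; ring]
    push_cast at hr ⊢
    have hk1 : (k : ℝ) + 1 ≠ 0 := by linarith
    apply mul_left_cancel₀ hk1
    rw [pow_succ]
    generalize Ring.choose ((k : ℝ) + α - 1 + 1) (k + 1) = B at *
    generalize Ring.choose ((k : ℝ) + α - 1) k = B' at *
    generalize Real.Gamma (2 * (k : ℝ) + 2 * α) = Γ' at *
    generalize Real.Gamma (2 * α) = Γ0 at *
    generalize (gegenbauer α (2 * k + 2)).eval 0 = g2 at *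
    generalize (gegenbauer α (2 * k)).eval 0 = g at *
    generalize ((2 * k).factorial : ℝ) = F at *
    generalize (-1 : ℝ) ^ k = s at *
    linear_combination (k + 1) * (2 * k + 2 * α) * Γ' * hr
      - (k + 1) * (2 * k + 1) * (2 * k + 2 * α) * ih
      + s * (2 * k + 2) * (2 * k + 1) * F * Γ0 * hch

theorem abs_gegenbauer_eval_le_caseFactor {α : ℝ} (hα : -(1 / 2 : ℝ) < α) (n : ℕ) {x : ℝ}
    (hx : |x| ≤ 1) : |(gegenbauer α (n + 1)).eval x| ≤ caseFactor α n := by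
  have hn : (0 : ℝ) ≤ n := n.cast_nonneg
  unfold caseFactor
  split_ifs with h0 he
  · have := sq_gegenbauer_eval_le_one h0 n hx
    exact (sq_le_one_iff_abs_le_one _).mp this
  · push Not at h0
    obtain ⟨k, rfl⟩ := even_iff_exists_two_mul.mp he
    have hN : 0 < 1 + ((2 * k : ℕ) : ℝ) + 2 * α := by linarith
    have hΓ := Real.Gamma_pos_of_pos hN
    have h := sq_gegenbauer_eval_le_of_neg hα h0 (2 * k) hx
    have hv := congrArg abs (gegenbauer_even_eval_zero hα h0 k)
    -- Parity kills one of the two terms of Sonin's function at `0`: here `G_{n+1}(0)`, and for odd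
    -- `n` the term with `G_n(0)`.
    rw [gegenbauer_odd_eval_zero] at h
    rw [show 1 + 2 * (k : ℝ) + 2 * α = 1 + ((2 * k : ℕ) : ℝ) + 2 * α by push_cast; ring] at hv
    simp only [abs_mul, abs_pow, abs_neg, abs_one, one_pow, one_mul, Nat.abs_cast, abs_two,
      abs_of_pos hΓ, abs_of_pos (by positivity : (0 : ℝ) < 2 * k + 1)] at hv
    have e : 2 * |α| * |Ring.choose (((2 * k : ℕ) : ℝ) / 2 + α) (2 * k / 2)|
        * ((2 * k + 1).factorial : ℝ) * |Real.Gamma (2 * α)|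
      / (Real.sqrt ((1 + ((2 * k : ℕ) : ℝ)) * (1 + ((2 * k : ℕ) : ℝ) + 2 * α))
          * Real.Gamma (1 + ((2 * k : ℕ) : ℝ) + 2 * α)) =
        |(gegenbauer α (2 * k)).eval 0| * (2 * k + 1) /
          Real.sqrt ((1 + ((2 * k : ℕ) : ℝ)) * (1 + ((2 * k : ℕ) : ℝ) + 2 * α)) := by
      rw [div_eq_div_iff (by positivity) (by positivity),
        Nat.mul_div_cancel_left k two_pos,
        show ((2 * k : ℕ) : ℝ) / 2 = k by push_cast; ring]
      linear_combination -Real.sqrt ((1 + ((2 * k : ℕ) : ℝ)) * (1 + ((2 * k : ℕ) : ℝ) + 2 * α)) * hv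
    rw [e]
    refine abs_le_of_sq_le_sq ?_ (by positivity)
    rw [div_pow, Real.sq_sqrt (by positivity), mul_pow, sq_abs]
    refine h.trans_eq ?_
    push_cast at hN ⊢
    have hN1 : 2 * (k : ℝ) + 1 + 2 * α ≠ 0 := by linarith
    rw [show 1 + 2 * (k : ℝ) + 2 * α = 2 * k + 1 + 2 * α by ring]
    field_simp
    ring
  · push Not at h0
    obtain ⟨k, rfl⟩ := Nat.not_even_iff_odd.mp he
    have hN : 0 < 1 + ((2 * k + 1 : ℕ) : ℝ) + 2 * α := by linarith
    have hΓ := Real.Gamma_pos_of_pos hN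
    have h := sq_gegenbauer_eval_le_of_neg hα h0 (2 * k + 1) hx
    have hv := congrArg abs (gegenbauer_even_succ_eval_zero hα h0 (k + 1))
    rw [gegenbauer_odd_eval_zero] at h
    rw [show 2 * ((k + 1 : ℕ) : ℝ) + 2 * α = 1 + ((2 * k + 1 : ℕ) : ℝ) + 2 * α by
      push_cast; ring, show ((k + 1 : ℕ) : ℝ) + α - 1 = k + α by push_cast; ring] at hv
    simp only [abs_mul, abs_pow, abs_neg, abs_one, one_pow, one_mul, Nat.abs_cast,
      abs_of_pos hΓ] at hv
    rw [show (2 * k + 1 + 1) / 2 = k + 1 by omega,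
      show (((2 * k + 1 : ℕ) : ℝ) - 1) / 2 = k by push_cast; ring,
      show 2 * k + 1 + 1 = 2 * (k + 1) by ring, ← hv, mul_div_cancel_right₀ _ hΓ.ne']
    rw [show 2 * k + 1 + 1 = 2 * (k + 1) by ring] at h
    exact sq_le_sq.mp (h.trans_eq (by ring))

/-! ### Degree and leading coefficient. -/

theorem gegenbauer_natDegree_le_coeff {α : ℝ} (hα : -(1 / 2 : ℝ) < α) (m : ℕ) :
    (gegenbauer α m).natDegree ≤ m ∧ (gegenbauer α (m + 1)).natDegree ≤ m + 1 ∧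
      (gegenbauer α (m + 1)).coeff (m + 1) * (Real.Gamma (1 + m + 2 * α) * Real.Gamma (1 + α)) =
        2 ^ m * Real.Gamma (1 + m + α) * Real.Gamma (1 + 2 * α) := by
  induction m with
  | zero => simp [gegenbauer, mul_comm]
  | succ m ih =>
    obtain ⟨h0, h1, h2⟩ := ih
    have hm : (0 : ℝ) ≤ m := m.cast_nonneg
    have hne : 1 + (m : ℝ) + 2 * α ≠ 0 := by linarith
    refine ⟨h1, ?_, ?_⟩
    · rw [gegenbauer]
      refine (natDegree_sub_le _ _).trans (max_le ?_ ?_)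
      · refine natDegree_mul_le.trans ?_
        have := natDegree_C_mul_le (2 * (((m : ℝ) + 1) + α) / (((m : ℝ) + 1) + 2 * α)) X
        have := natDegree_X_le (R := ℝ)
        omega
      · have := natDegree_C_mul_le (((m : ℝ) + 1) / (((m : ℝ) + 1) + 2 * α)) (gegenbauer α m)
        omega
    · have hr := congrArg (fun p => p.coeff (m + 2)) (gegenbauer_recurrence hα m)
      simp only [coeff_sub, mul_assoc, coeff_C_mul, coeff_X_mul,
        coeff_eq_zero_of_natDegree_lt (by omega : (gegenbauer α m).natDegree < m + 2)] at hr
      have g1 : Real.Gamma (1 + ((m + 1 : ℕ) : ℝ) + 2 * α) =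
          (1 + m + 2 * α) * Real.Gamma (1 + m + 2 * α) := by
        rw [← Real.Gamma_add_one (by linarith)]; push_cast; ring_nf
      have g2 : Real.Gamma (1 + ((m + 1 : ℕ) : ℝ) + α) =
          (1 + m + α) * Real.Gamma (1 + m + α) := by
        rw [← Real.Gamma_add_one (by linarith)]; push_cast; ring_nf
      rw [g1, g2, pow_succ]
      linear_combination Real.Gamma (1 + m + 2 * α) * Real.Gamma (1 + α) * hr
        + 2 * (m + 1 + α) * h2

/-! ### Repeated integrals and the integral form of the quadrature error. -/

theorem continuous_foldIntegral {f : ℝ → ℝ} (hf : Continuous f) (q : ℕ) :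
    Continuous (foldIntegral f q) := by
  induction q with
  | zero => exact hf
  | succ q ih =>
    exact intervalIntegral.continuous_primitive (fun a b => ih.intervalIntegrable a b) 0

theorem hasDerivAt_foldIntegral_succ {f : ℝ → ℝ} (hf : Continuous f) (q : ℕ) (t : ℝ) :
    HasDerivAt (foldIntegral f (q + 1)) (foldIntegral f q t) t :=
  intervalIntegral.integral_hasDerivAt_right
    ((continuous_foldIntegral hf q).intervalIntegrable _ _)
    ((continuous_foldIntegral hf q).stronglyMeasurableAtFilter _ _)
    (continuous_foldIntegral hf q).continuousAt

theorem foldIntegral_congr {f g : ℝ → ℝ} {l : ℝ} (h : Set.EqOn f g (Set.Icc 0 l)) (q : ℕ) :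
    Set.EqOn (foldIntegral f q) (foldIntegral g q) (Set.Icc 0 l) := by
  induction q with
  | zero => exact h
  | succ q ih =>
    intro t ht
    refine intervalIntegral.integral_congr fun s hs => ih ?_
    rw [Set.uIcc_of_le ht.1] at hs
    exact ⟨hs.1, hs.2.trans ht.2⟩

/-- Cauchy's formula for repeated integration, with a number of integrations left over. -/
theorem integral_pow_mul_foldIntegral {f : ℝ → ℝ} (hf : Continuous f) (k q : ℕ) (t : ℝ) :
    ∫ s in (0 : ℝ)..t, (t - s) ^ k * foldIntegral f q s =
      k.factorial * foldIntegral f (q + k + 1) t := by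
  induction k generalizing q with
  | zero => simp [foldIntegral]
  | succ k ih =>
    have hu : ∀ s ∈ Set.uIcc 0 t,
        HasDerivAt (fun s => (t - s) ^ (k + 1)) (-((k + 1 : ℝ) * (t - s) ^ k)) s := by
      intro s _
      have h := ((hasDerivAt_id s).const_sub t).fun_pow (k + 1)
      refine h.congr_deriv ?_
      simp
    -- Both boundary terms vanish: the power at `s = t`, the repeated integral at `s = 0`.
    rw [intervalIntegral.integral_mul_deriv_eq_deriv_mul hu
      (fun s _ => hasDerivAt_foldIntegral_succ hf q s)
      (Continuous.intervalIntegrable (by fun_prop) _ _)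
      ((continuous_foldIntegral hf q).intervalIntegrable _ _)]
    simp only [sub_self, ne_eq, Nat.add_eq_zero_iff, one_ne_zero, and_false, not_false_eq_true,
      zero_pow, zero_mul, neg_mul, intervalIntegral.integral_neg, mul_assoc,
      intervalIntegral.integral_const_mul, ih (q + 1)]
    rw [show foldIntegral f (q + 1) 0 = 0 by simp [foldIntegral], Nat.factorial_succ,
      show q + 1 + k + 1 = q + (k + 1) + 1 by ring]
    push_cast
    ring

theorem foldIntegral_eq_integral {f : ℝ → ℝ} {l : ℝ} (hl : 0 ≤ l)
    (hf : ContinuousOn f (Set.Icc 0 l)) (k : ℕ) {t : ℝ} (ht : t ∈ Set.Icc 0 l) :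
    foldIntegral f (k + 1) t =
      (k.factorial : ℝ)⁻¹ * ∫ s in (0 : ℝ)..t, (t - s) ^ k * f s := by
  -- Continuity is known only on `[0, l]`; the extension by constants is continuous everywhere and
  -- has the same repeated integrals there.
  let F : ℝ → ℝ := Set.IccExtend hl ((Set.Icc 0 l).domRestrict f)
  have hF : Continuous F := hf.domRestrict.Icc_extend'
  have hfF : Set.EqOn f F (Set.Icc 0 l) := fun s hs => 
    (Set.IccExtend_of_mem hl ((Set.Icc 0 l).domRestrict f) hs).symm
  have h := integral_pow_mul_foldIntegral hF k 0 t
  rw [zero_add, ← foldIntegral_congr hfF (k + 1) ht] at h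
  have h2 : ∫ s in (0 : ℝ)..t, (t - s) ^ k * f s =
      ∫ s in (0 : ℝ)..t, (t - s) ^ k * foldIntegral F 0 s := by
    refine intervalIntegral.integral_congr fun s hs => ?_
    rw [Set.uIcc_of_le ht.1] at hs
    simp only [foldIntegral, hfF ⟨hs.1, hs.2.trans ht.2⟩]
  rw [h2, h, inv_mul_cancel_left₀ (by positivity)]

theorem lagrangeBasis_eval_shift {n : ℕ} {l : ℝ} (hl : 0 < l) (x : Fin (n + 1) → ℝ)
    (j : Fin (n + 1)) (s : ℝ) :
    (lagrangeBasis (fun j => 2 * x j / l - 1) j).eval (2 / l * s - 1) =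
      (lagrangeBasis x j).eval s := by
  simp only [lagrangeBasis, Lagrange.basis, Lagrange.basisDivisor, eval_prod, eval_mul, eval_sub,
    eval_C, eval_X]
  refine Finset.prod_congr rfl fun k _ => ?_
  rw [show 2 * x j / l - 1 - (2 * x k / l - 1) = 2 / l * (x j - x k) by ring,
    show 2 / l * s - 1 - (2 * x k / l - 1) = 2 / l * (s - x k) by ring, mul_inv]
  field_simp

theorem integral_lagrangeBasis_shift {n : ℕ} {l : ℝ} (hl : 0 < l) (x : Fin (n + 1) → ℝ)
    (j : Fin (n + 1)) (t : ℝ) :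
    l / 2 * ∫ s in (-1 : ℝ)..(2 * t / l - 1),
        (lagrangeBasis (fun j => 2 * x j / l - 1) j).eval s =
      ∫ s in (0 : ℝ)..t, (lagrangeBasis x j).eval s := by
  have h := intervalIntegral.integral_comp_mul_sub (a := 0) (b := t)
    (fun s => (lagrangeBasis (fun j => 2 * x j / l - 1) j).eval s)
    (c := 2 / l) (by positivity) 1
  simp only [lagrangeBasis_eval_shift hl] at h
  rw [h, smul_eq_mul, inv_div, mul_zero, zero_sub, mul_div_right_comm]

/-- Of the factors in `(l / 2) ^ (k + 1)`, one comes from the change of variable in the integral of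
the Lagrange polynomial and `k` from rescaling the node differences. -/
theorem bsgqError_eq_integral {n : ℕ} {l : ℝ} (hl : 0 < l) (x : Fin (n + 1) → ℝ) (k : ℕ)
    {f : ℝ → ℝ} (hf : ContinuousOn f (Set.Icc 0 l)) (i : Fin (n + 1)) (hi : x i ∈ Set.Icc 0 l) :
    bsgqError l x (k + 1) f i = (k.factorial : ℝ)⁻¹ * ∫ s in (0 : ℝ)..(x i),
      ((x i - s) ^ k * f s -
        (Lagrange.interpolate Finset.univ x fun j => (x i - x j) ^ k * f (x j)).eval s) := by
  have hc : ContinuousOn (fun s => (x i - s) ^ k * f s) (Set.uIcc 0 (x i)) := by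
    rw [Set.uIcc_of_le hi.1]
    exact ContinuousOn.mul (by fun_prop) (hf.mono (Set.Icc_subset_Icc_right hi.2))
  rw [intervalIntegral.integral_sub hc.intervalIntegrable
    ((Polynomial.continuous _).intervalIntegrable _ _), mul_sub, bsgqError,
    foldIntegral_eq_integral hl.le hf k hi]
  congr 1
  simp only [Lagrange.interpolate_apply, eval_finsetSum, eval_mul, eval_C]
  rw [intervalIntegral.integral_finsetSum
    fun j _ => (Continuous.intervalIntegrable (by fun_prop) _ _), Finset.mul_sum]
  simp only [Matrix.mulVec, dotProduct]
  refine Finset.sum_congr rfl fun j _ => ?_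
  rw [intervalIntegral.integral_const_mul]
  have h := integral_lagrangeBasis_shift hl x j (x i)
  rw [show ∫ s in (0 : ℝ)..(x i), (Lagrange.basis Finset.univ x j).eval s =
    ∫ s in (0 : ℝ)..(x i), (lagrangeBasis x j).eval s from rfl, ← h]
  simp only [bsgim, gim, Matrix.smul_apply, Matrix.of_apply, smul_eq_mul, Nat.add_sub_cancel]
  rw [show 2 * x i / l - 1 - (2 * x j / l - 1) = 2 / l * (x i - x j) by ring, mul_pow, div_pow,
    div_pow, pow_succ, pow_succ]
  field_simp

/-! ### Error of Lagrange interpolation. -/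

/-- Rolle's theorem, iterated. -/
theorem exists_zero_of_card_zeros {a b : ℝ} (N : ℕ) (F : ℕ → ℝ → ℝ)
    (hc : ∀ k ≤ N, ContinuousOn (F k) (Set.Icc a b))
    (hd : ∀ k ≤ N, ∀ t ∈ Set.Ioo a b, HasDerivAt (F k) (F (k + 1) t) t)
    (y : Fin (N + 2) → ℝ) (hy : StrictMono y) (hyI : ∀ i, y i ∈ Set.Icc a b)
    (hF : ∀ i, F 0 (y i) = 0) : ∃ ζ ∈ Set.Ioo a b, F (N + 1) ζ = 0 := by
  induction N generalizing F with
  | zero =>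
    have hlt : y 0 < y 1 := hy Fin.zero_lt_one
    obtain ⟨c, hcI, hc0⟩ := exists_hasDerivAt_eq_zero hlt
      ((hc 0 le_rfl).mono (Set.Icc_subset_Icc (hyI 0).1 (hyI 1).2)) ((hF 0).trans (hF 1).symm)
      fun t ht => hd 0 le_rfl t ⟨(hyI 0).1.trans_lt ht.1, ht.2.trans_le (hyI 1).2⟩
    exact ⟨c, ⟨(hyI 0).1.trans_lt hcI.1, hcI.2.trans_le (hyI 1).2⟩, hc0⟩
  | succ N ih =>
    have key : ∀ i : Fin (N + 2), ∃ c ∈ Set.Ioo (y i.castSucc) (y i.succ), F 1 c = 0 := fun i =>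
      exists_hasDerivAt_eq_zero (hy i.castSucc_lt_succ)
        ((hc 0 (Nat.zero_le _)).mono (Set.Icc_subset_Icc (hyI _).1 (hyI _).2))
        ((hF _).trans (hF _).symm)
        fun t ht => hd 0 (Nat.zero_le _) t ⟨(hyI _).1.trans_lt ht.1, ht.2.trans_le (hyI _).2⟩
    choose c hcI hc0 using key
    refine ih (fun k => F (k + 1)) (fun k hk => hc _ (by omega)) (fun k hk => hd _ (by omega)) c
      ?_ (fun i => ⟨(hyI _).1.trans (hcI i).1.le, (hcI i).2.le.trans (hyI _).2⟩) hc0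
    refine Fin.strictMono_iff_lt_succ.mpr fun i => (hcI _).2.trans ?_
    simpa only [Fin.succ_castSucc] using (hcI i.succ).1

theorem Polynomial.Monic.iterate_derivative_natDegree {R : Type*} [CommRing R] {p : R[X]}
    (hp : p.Monic) : derivative^[p.natDegree] p = C (p.natDegree.factorial : R) := by
  rw [eq_C_of_natDegree_le_zero ((natDegree_iterate_derivative p _).trans_eq (Nat.sub_self _)),
    coeff_iterate_derivative, zero_add, Nat.descFactorial_self, hp.coeff_natDegree, nsmul_one]

theorem ContDiffOn.hasDerivAt_iteratedDerivWithin {g : ℝ → ℝ} {a b : ℝ} (hab : a < b) {n : ℕ}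
    (hg : ContDiffOn ℝ n g (Set.Icc a b)) {k : ℕ} (hk : k < n) {t : ℝ} (ht : t ∈ Set.Ioo a b) :
    HasDerivAt (iteratedDerivWithin k g (Set.Icc a b))
      (iteratedDerivWithin (k + 1) g (Set.Icc a b) t) t := by
  rw [iteratedDerivWithin_succ]
  exact (hg.differentiableOn_iteratedDerivWithin (mod_cast hk) (uniqueDiffOn_Icc hab) t
    (Set.Ioo_subset_Icc_self ht)).hasDerivWithinAt.hasDerivAt (Icc_mem_nhds ht.1 ht.2)

/-- The error formula of Lagrange interpolation. -/
theorem exists_sub_interpolate_eq {g : ℝ → ℝ} {a b : ℝ} (hab : a < b) {n : ℕ}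
    (hg : ContDiffOn ℝ ((n + 1 : ℕ) : ℕ∞) g (Set.Icc a b)) (x : Fin (n + 1) → ℝ)
    (hx : Function.Injective x) (hxI : ∀ i, x i ∈ Set.Icc a b) {τ : ℝ} (hτ : τ ∈ Set.Icc a b) :
    ∃ ζ ∈ Set.Ioo a b, g τ - (Lagrange.interpolate Finset.univ x fun j => g (x j)).eval τ =
      iteratedDerivWithin (n + 1) g (Set.Icc a b) ζ / ((n + 1).factorial : ℝ) *
        (Lagrange.nodal Finset.univ x).eval τ := by
  set P := Lagrange.interpolate Finset.univ x fun j => g (x j) with hP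
  set ω := Lagrange.nodal Finset.univ x with hω
  have hPx : ∀ j, P.eval (x j) = g (x j) := fun j =>
    Lagrange.eval_interpolate_at_node _ hx.injOn (Finset.mem_univ j)
  have hωx : ∀ j, ω.eval (x j) = 0 := fun j => Lagrange.eval_nodal_at_node (Finset.mem_univ j)
  by_cases hτx : τ ∈ Set.range x
  · obtain ⟨j, rfl⟩ := hτx
    obtain ⟨ζ, hζ⟩ := Set.nonempty_Ioo.mpr hab
    exact ⟨ζ, hζ, by rw [hPx, hωx, sub_self, mul_zero]⟩
  have hω0 : ω.eval τ ≠ 0 := Lagrange.eval_nodal_not_at_node fun j _ h => hτx ⟨j, h.symm⟩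
  -- This `c` makes `g - Q` vanish at `τ` as well as at the nodes, which gives the `n + 2` zeros
  -- required for Rolle.
  set c := (g τ - P.eval τ) / ω.eval τ with hcdef
  set Q := P + C c * ω with hQ
  have hωdeg : ω.natDegree = n + 1 := by rw [hω, Lagrange.natDegree_nodal]; simp
  have hQd : derivative^[n + 1] Q = C (c * ((n + 1).factorial : ℝ)) := by
    have h1 : derivative^[n + 1] P = 0 := by
      refine iterate_derivative_eq_zero_of_degree_lt ?_
      have h := Lagrange.degree_interpolate_lt (s := Finset.univ) (v := x)
        (fun j => g (x j)) hx.injOn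
      rwa [← hP, Finset.card_univ, Fintype.card_fin] at h
    have h2 := (Lagrange.nodal_monic (s := Finset.univ) (v := x)).iterate_derivative_natDegree
    rw [← hω, hωdeg] at h2
    rw [hQ, iterate_map_add, h1, zero_add, iterate_derivative_C_mul, h2, C_mul]
  have hQx : ∀ j, g (x j) - Q.eval (x j) = 0 := fun j => by simp [hQ, hPx, hωx]
  have hQτ : g τ - Q.eval τ = 0 := by
    simp [hQ, hcdef, hω0]
  let s : Finset ℝ := insert τ (Finset.univ.image x)
  have hs : s.card = n + 2 := by
    rw [Finset.card_insert_of_notMem (by simpa using hτx), Finset.card_image_of_injective _ hx]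
    simp
  have hsmem : ∀ t ∈ s, t ∈ Set.Icc a b ∧ g t - Q.eval t = 0 := by
    intro t ht
    simp only [s, Finset.mem_insert, Finset.mem_image, Finset.mem_univ, true_and] at ht
    rcases ht with rfl | ⟨j, rfl⟩
    · exact ⟨hτ, hQτ⟩
    · exact ⟨hxI j, hQx j⟩
  obtain ⟨ζ, hζ, h0⟩ := exists_zero_of_card_zeros n
    (fun k t => iteratedDerivWithin k g (Set.Icc a b) t - (derivative^[k] Q).eval t)
    (fun k hk => (hg.continuousOn_iteratedDerivWithin
      (mod_cast hk.trans n.le_succ) (uniqueDiffOn_Icc hab)).sub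
        (Polynomial.continuous _).continuousOn)
    (fun k hk t ht => by
      rw [Function.iterate_succ_apply']
      exact (hg.hasDerivAt_iteratedDerivWithin hab (Nat.lt_succ_of_le hk) ht).sub
        ((derivative^[k] Q).hasDerivAt t))
    (s.orderEmbOfFin hs) (s.orderEmbOfFin hs).strictMono
    (fun i => (hsmem _ (s.orderEmbOfFin_mem hs i)).1)
    (fun i => by simpa using (hsmem _ (s.orderEmbOfFin_mem hs i)).2)
  refine ⟨ζ, hζ, ?_⟩
  simp only [hQd, eval_C] at h0
  rw [sub_eq_zero.mp h0, mul_div_cancel_right₀ _ (by positivity), hcdef, div_mul_cancel₀ _ hω0]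

/-! ### Derivatives of the kernel times the integrand. -/

theorem factorial_le_nMax (n q : ℕ) (x ζ : ℝ) : ((q - 1).factorial : ℝ) ≤ nMax n q x ζ :=
  le_max_left _ _

theorem descFactorial_mul_abs_pow_le_nMax (n k : ℕ) (x ζ : ℝ) {i : ℕ} (hi : i ≤ n + 1) :
    (k.descFactorial i : ℝ) * |x - ζ| ^ (k - i) ≤ nMax n (k + 1) x ζ := by
  rcases lt_or_ge k i with h | h
  · rw [Nat.descFactorial_eq_zero_iff_lt.mpr h, Nat.cast_zero, zero_mul]
    exact (Nat.cast_nonneg _).trans (factorial_le_nMax n (k + 1) x ζ)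
  · refine le_max_of_le_right ?_
    have hle := le_ciSup (f := fun j : Fin (n + 2) =>
      (descPochhammer ℝ (n + 1 - (j : ℕ))).eval (((k + 1 : ℕ) : ℝ) - 1) *
        |x - ζ| ^ (((k + 1 : ℕ) : ℤ) - (n : ℤ) + ((j : ℕ) : ℤ) - 2))
      -- The supremum is indexed by the order of the derivative falling on `f`, hence `n + 1 - i`
      -- when `i` derivatives fall on the kernel.
      (Set.finite_range _).bddAbove ⟨n + 1 - i, by omega⟩
    refine le_of_eq_of_le ?_ hle
    have e1 : n + 1 - (n + 1 - i) = i := by omega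
    have e2 : ((k + 1 : ℕ) : ℤ) - (n : ℤ) + ((n + 1 - i : ℕ) : ℤ) - 2 = ((k - i : ℕ) : ℤ) := by
      omega
    simp only [e1]
    rw [e2, zpow_natCast]
    simp only [Nat.cast_add, Nat.cast_one, add_sub_cancel_right,
      descPochhammer_eval_eq_descFactorial]

theorem abs_iteratedDerivWithin_const_sub_pow {a b : ℝ} (hab : a < b) (x : ℝ) (k i : ℕ) {t : ℝ}
    (ht : t ∈ Set.Icc a b) :
    |iteratedDerivWithin i (fun s => (x - s) ^ k) (Set.Icc a b) t| =
      (k.descFactorial i : ℝ) * |x - t| ^ (k - i) := by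
  rw [iteratedDerivWithin_eq_iteratedDeriv (uniqueDiffOn_Icc hab)
    (ContDiff.contDiffAt (by fun_prop)) ht]
  have h := iteratedDeriv_comp_const_sub i (fun s : ℝ => s ^ k) x
  simp [h]

theorem abs_iteratedDerivWithin_kernel_mul_le {f : ℝ → ℝ} {l A : ℝ} (hl : 0 < l) {n : ℕ}
    (hf : ContDiffOn ℝ ((n + 1 : ℕ) : ℕ∞) f (Set.Icc 0 l))
    (hbound : ∀ k : ℕ, k ≤ n + 1 → ∀ t ∈ Set.Icc (0 : ℝ) l,
      |iteratedDerivWithin k f (Set.Icc 0 l) t| ≤ A) (k : ℕ) (x : ℝ) {t : ℝ}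
    (ht : t ∈ Set.Icc 0 l) :
    |iteratedDerivWithin (n + 1) (fun s => (x - s) ^ k * f s) (Set.Icc 0 l) t| ≤
      2 ^ (n + 1) * A * nMax n (k + 1) x t := by
  have hM := (Nat.cast_nonneg _).trans (factorial_le_nMax n (k + 1) x t)
  have h := iteratedDerivWithin_mul (n := n + 1) (f := fun s => (x - s) ^ k) (g := f) ht
    (uniqueDiffOn_Icc hl) (ContDiff.contDiffWithinAt (by fun_prop)) (hf t ht)
  rw [show (fun s => (x - s) ^ k * f s) = (fun s => (x - s) ^ k) * f from rfl, h]
  refine (Finset.abs_sum_le_sum_abs _ _).trans ?_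
  have hsum : ∑ i ∈ Finset.range (n + 1 + 1), ((n + 1).choose i : ℝ) = 2 ^ (n + 1) := by
    exact_mod_cast Nat.sum_range_choose (n + 1)
  rw [← hsum, mul_assoc, Finset.sum_mul]
  refine Finset.sum_le_sum fun i hi => ?_
  rw [abs_mul, abs_mul, Nat.abs_cast, abs_iteratedDerivWithin_const_sub_pow hl x k i ht, mul_assoc,
    mul_comm A]
  exact mul_le_mul_of_nonneg_left (mul_le_mul
    (descFactorial_mul_abs_pow_le_nMax n k x t (Nat.lt_succ_iff.mp (Finset.mem_range.mp hi)))
    (hbound _ (Nat.sub_le _ _) t ht) (abs_nonneg _) hM) (Nat.cast_nonneg _)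

/-! ### The nodal polynomial of the shifted Gegenbauer–Gauss nodes. -/

/-- Every zero of a shifted Gegenbauer polynomial lies in the open interval. -/
theorem IsSGGNodes.mem_Ioo {l α : ℝ} (hl : 0 < l) (hα : -(1 / 2 : ℝ) < α) {n : ℕ}
    {x : Fin (n + 1) → ℝ} (hx : IsSGGNodes l α n x) (i : Fin (n + 1)) : x i ∈ Set.Ioo 0 l := by
  have h : x i ∈ Set.range x := ⟨i, rfl⟩
  rw [hx.2] at h
  have h1 : (gegenbauer α (n + 1)).IsRoot (2 / l * x i - 1) := by
    simpa [shiftedGegenbauer, IsRoot.def, eval_comp] using h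
  have h2 := abs_lt.mp (abs_lt_one_of_gegenbauer_isRoot hα h1)
  have h3 : 2 / l * x i = 2 * (x i / l) := by ring
  rw [h3] at h2
  have h4 : 0 < x i / l := by linarith
  have h5 : x i / l < 1 := by linarith
  exact ⟨by simpa [hl] using (div_pos_iff_of_pos_right hl).mp h4, (div_lt_one hl).mp h5⟩

theorem IsSGGNodes.gegenbauer_eval_eq {l α : ℝ} (hl : 0 < l) (hα : -(1 / 2 : ℝ) < α) {n : ℕ}
    {x : Fin (n + 1) → ℝ} (hx : IsSGGNodes l α n x) (t : ℝ) :
    (gegenbauer α (n + 1)).eval (2 / l * t - 1) * l ^ (n + 1) =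
      (gegenbauer α (n + 1)).coeff (n + 1) * 2 ^ (n + 1) *
        (Lagrange.nodal Finset.univ x).eval t := by
  set K := (gegenbauer α (n + 1)).coeff (n + 1) with hK
  have hdeg := (gegenbauer_natDegree_le_coeff hα n).2.1
  set p := shiftedGegenbauer l α (n + 1) with hp
  have hlin : (C (2 / l) * X - 1 : ℝ[X]) = C (2 / l) * X + C (-1) := by simp [sub_eq_add_neg]
  have hlind : (C (2 / l) * X - 1 : ℝ[X]).natDegree = 1 := by
    rw [hlin]; exact natDegree_linear (by positivity)
  have hpdeg : p.natDegree ≤ n + 1 := by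
    rw [hp, shiftedGegenbauer, natDegree_comp, hlind, mul_one]; exact hdeg
  have hpc : p.coeff (n + 1) = K * (2 / l) ^ (n + 1) := by
    have hn : (0 : ℝ) ≤ n := n.cast_nonneg
    have G3 : 0 < Real.Gamma (1 + (n : ℝ) + α) := Real.Gamma_pos_of_pos (by linarith)
    have G4 : 0 < Real.Gamma (1 + 2 * α) := Real.Gamma_pos_of_pos (by linarith)
    -- The Gamma identity for `K` has a positive right side, so the degree is exactly `n + 1`; the
    -- leading coefficient of the composition depends on this.
    have hK0 : K ≠ 0 := left_ne_zero_of_mul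
      ((gegenbauer_natDegree_le_coeff hα n).2.2.trans_ne (by positivity))
    have hd : (gegenbauer α (n + 1)).natDegree = n + 1 :=
      natDegree_eq_of_le_of_coeff_ne_zero hdeg hK0
    have h := coeff_comp_degree_mul_degree (p := gegenbauer α (n + 1))
      (q := C (2 / l) * X - 1) (by rw [hlind]; exact one_ne_zero)
    rw [hlind, mul_one, hd, leadingCoeff, hd, leadingCoeff, hlind] at h
    rw [hp, shiftedGegenbauer, h, hlin, coeff_add, coeff_C_mul, coeff_X_one,
      coeff_C_succ, mul_one, add_zero]
  have hroot : ∀ j, p.eval (x j) = 0 := fun j => by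
    have h : x j ∈ Set.range x := ⟨j, rfl⟩
    rw [hx.2] at h
    exact h
  have heq : p = C (K * (2 / l) ^ (n + 1)) * Lagrange.nodal Finset.univ x := by
    -- The leading terms agree, so the difference has degree below `n + 1` and vanishes at `n + 1`
    -- distinct nodes.
    refine Polynomial.eq_of_degree_sub_lt_of_eval_index_eq (s := Finset.univ) (v := x)
      hx.1.injective.injOn ?_ fun j _ => ?_
    · rw [degree_lt_iff_coeff_zero]
      intro m hm
      simp only [Finset.card_univ, Fintype.card_fin] at hm
      have hnd : (Lagrange.nodal Finset.univ x).natDegree = n + 1 := by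
        rw [Lagrange.natDegree_nodal]; simp
      rw [coeff_sub, coeff_C_mul]
      rcases hm.eq_or_lt with rfl | hm
      · have hm1 : (Lagrange.nodal Finset.univ x).coeff (n + 1) = 1 := by
          simpa only [hnd] using
            (Lagrange.nodal_monic (s := Finset.univ) (v := x)).coeff_natDegree
        rw [hpc, hm1, mul_one, sub_self]
      · rw [coeff_eq_zero_of_natDegree_lt (by omega), coeff_eq_zero_of_natDegree_lt (by omega)]
        simp
    · rw [hroot, eval_mul, Lagrange.eval_nodal_at_node (Finset.mem_univ j), mul_zero]
  have h := congrArg (Polynomial.eval t) heq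
  simp only [hp, shiftedGegenbauer, eval_comp, eval_sub, eval_mul, eval_C, eval_X, eval_one] at h
  rw [h, div_pow]
  field_simp

/-- The power `2 ^ (2 * n + 1)` combines `2 ^ n` from the leading coefficient with `2 ^ (n + 1)`
from the affine map onto `[-1, 1]`. -/
theorem IsSGGNodes.abs_nodal_eval_le {l α : ℝ} (hl : 0 < l) (hα : -(1 / 2 : ℝ) < α) {n : ℕ}
    {x : Fin (n + 1) → ℝ} (hx : IsSGGNodes l α n x) {t : ℝ} (ht : t ∈ Set.Icc 0 l) :
    |(Lagrange.nodal Finset.univ x).eval t| ≤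
      l ^ (n + 1) / 2 ^ (2 * n + 1) *
        (Real.Gamma (1 + α) * Real.Gamma (1 + (n : ℝ) + 2 * α) /
          (Real.Gamma (1 + (n : ℝ) + α) * Real.Gamma (1 + 2 * α))) * caseFactor α n := by
  have hn : (0 : ℝ) ≤ n := n.cast_nonneg
  have G1 : 0 < Real.Gamma (1 + α) := Real.Gamma_pos_of_pos (by linarith)
  have G2 : 0 < Real.Gamma (1 + (n : ℝ) + 2 * α) := Real.Gamma_pos_of_pos (by linarith)
  have G3 : 0 < Real.Gamma (1 + (n : ℝ) + α) := Real.Gamma_pos_of_pos (by linarith)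
  have G4 : 0 < Real.Gamma (1 + 2 * α) := Real.Gamma_pos_of_pos (by linarith)
  have hK := (gegenbauer_natDegree_le_coeff hα n).2.2
  have hE := hx.gegenbauer_eval_eq hl hα t
  have hz : |2 / l * t - 1| ≤ 1 := by
    have h1 : 2 / l * t = 2 * (t / l) := by ring
    have h2 : 0 ≤ t / l := div_nonneg ht.1 hl.le
    have h3 : t / l ≤ 1 := (div_le_one hl).mpr ht.2
    rw [h1, abs_le]
    constructor <;> linarith
  have hG := abs_gegenbauer_eval_le_caseFactor hα n hz
  have hKeq : (Lagrange.nodal Finset.univ x).eval t = l ^ (n + 1) / 2 ^ (2 * n + 1) *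
        (Real.Gamma (1 + α) * Real.Gamma (1 + (n : ℝ) + 2 * α) /
          (Real.Gamma (1 + (n : ℝ) + α) * Real.Gamma (1 + 2 * α))) *
          (gegenbauer α (n + 1)).eval (2 / l * t - 1) := by
    clear hG hz
    generalize (gegenbauer α (n + 1)).eval (2 / l * t - 1) = u at *
    generalize Real.Gamma (1 + α) = g1 at *
    generalize Real.Gamma (1 + (n : ℝ) + 2 * α) = g2 at *
    generalize Real.Gamma (1 + (n : ℝ) + α) = g3 at *
    generalize Real.Gamma (1 + 2 * α) = g4 at *
    field_simp
    linear_combination -(g1 * g2) * hE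
        - 2 ^ (n + 1) * (Lagrange.nodal Finset.univ x).eval t * hK
  rw [hKeq, abs_mul, abs_of_nonneg (by positivity)]
  exact mul_le_mul_of_nonneg_left hG (by positivity)

/-! ### The error bound. -/

theorem mainTheorem5
    (n q : ℕ) (hq : 1 ≤ q)
    (l α : ℝ) (hl : 0 < l) (hα : -(1 / 2 : ℝ) < α)
    (x : Fin (n + 1) → ℝ) (hx : IsSGGNodes l α n x)
    (f : ℝ → ℝ) (hf : ContDiffOn ℝ ((n + 1 : ℕ) : ℕ∞) f (Set.Icc 0 l))
    (Amax : ℝ) (hA : 0 < Amax)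
    (hbound : ∀ k : ℕ, k ≤ n + 1 → ∀ t ∈ Set.Icc (0 : ℝ) l,
      |iteratedDerivWithin k f (Set.Icc 0 l) t| ≤ Amax) :
    ∃ ζ : Fin (n + 1) → ℝ, ∀ i : Fin (n + 1), ζ i ∈ Set.Ioo (0 : ℝ) l ∧
      |bsgqError l x q f i| ≤
        (2 : ℝ) ^ (-(n : ℤ)) * Amax * l ^ (1 + n) * nMax n q (x i) (ζ i) * x i
            * Real.Gamma (1 + α) * Real.Gamma (1 + (n : ℝ) + 2 * α)
          / (((n + 1).factorial : ℝ) * ((q - 1).factorial : ℝ)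
            * Real.Gamma (1 + (n : ℝ) + α) * Real.Gamma (1 + 2 * α))
          * caseFactor α n := by
  obtain ⟨k, rfl⟩ := Nat.exists_eq_add_of_le' hq
  suffices H : ∀ i : Fin (n + 1), ∃ z : ℝ, z ∈ Set.Ioo (0 : ℝ) l ∧
      |bsgqError l x (k + 1) f i| ≤
        (2 : ℝ) ^ (-(n : ℤ)) * Amax * l ^ (1 + n) * nMax n (k + 1) (x i) z * x i
            * Real.Gamma (1 + α) * Real.Gamma (1 + (n : ℝ) + 2 * α)
          / (((n + 1).factorial : ℝ) * ((k + 1 - 1).factorial : ℝ)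
            * Real.Gamma (1 + (n : ℝ) + α) * Real.Gamma (1 + 2 * α))
          * caseFactor α n by
    choose ζ hζ using H
    exact ⟨ζ, hζ⟩
  intro i
  have hxI : ∀ j, x j ∈ Set.Icc 0 l := fun j => Set.Ioo_subset_Icc_self (hx.mem_Ioo hl hα j)
  have hi := hx.mem_Ioo hl hα i
  have hg : ContDiffOn ℝ ((n + 1 : ℕ) : ℕ∞) (fun s => (x i - s) ^ k * f s) (Set.Icc 0 l) :=
    ContDiffOn.mul (ContDiff.contDiffOn (by fun_prop)) hf
  set P := Lagrange.interpolate Finset.univ x fun j => (x i - x j) ^ k * f (x j) with hP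
  have hcont : ContinuousOn (fun s => (x i - s) ^ k * f s - P.eval s) (Set.uIcc 0 (x i)) := by
    rw [Set.uIcc_of_le hi.1.le]
    exact (hg.continuousOn.mono (Set.Icc_subset_Icc_right hi.2.le)).sub P.continuous.continuousOn
  -- Taking the mean value before the interpolation formula yields a single `ζ` per node, instead of
  -- one varying with the integration variable.
  obtain ⟨τ, hτ, hmean⟩ := exists_eq_interval_average hi.1.ne hcont
  rw [Set.uIoo_of_le hi.1.le] at hτ
  rw [interval_average_eq_div, sub_zero, eq_div_iff hi.1.ne'] at hmean
  have hτI : τ ∈ Set.Icc 0 l := ⟨hτ.1.le, (hτ.2.trans hi.2).le⟩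
  obtain ⟨ζ, hζ, herr⟩ := exists_sub_interpolate_eq hl hg x hx.1.injective hxI hτI
  refine ⟨ζ, hζ, ?_⟩
  have hD := abs_iteratedDerivWithin_kernel_mul_le hl hf hbound k (x i)
    (Set.Ioo_subset_Icc_self hζ)
  have hω := hx.abs_nodal_eval_le hl hα hτI
  have hM := (Nat.cast_nonneg _).trans (factorial_le_nMax n (k + 1) (x i) ζ)
  rw [bsgqError_eq_integral hl x k hf.continuousOn i (hxI i), ← hmean, herr]
  rw [abs_mul, abs_mul, abs_mul, abs_div, abs_of_pos hi.1, Nat.abs_cast,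
    abs_of_pos (by positivity : (0 : ℝ) < (k.factorial : ℝ)⁻¹)]
  have hprod := mul_le_mul hD hω (abs_nonneg _) (by positivity)
  have hprod' := mul_le_mul_of_nonneg_left hprod
    (by have := hi.1; positivity : 0 ≤ (k.factorial : ℝ)⁻¹ * x i / ((n + 1).factorial : ℝ))
  refine (le_of_eq_of_le ?_ hprod').trans_eq ?_
  · ring
  -- The powers of two combine as `2 ^ (n + 1) / 2 ^ (2 * n + 1) = 2 ^ (-n)`.
  · rw [Nat.add_sub_cancel, zpow_neg, zpow_natCast, add_comm 1 n, pow_succ, pow_succ,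
      show (2 : ℝ) ^ (2 * n + 1) = 2 ^ n * 2 ^ n * 2 by ring]
    have hn : (0 : ℝ) ≤ n := n.cast_nonneg
    have G3 : 0 < Real.Gamma (1 + (n : ℝ) + α) := Real.Gamma_pos_of_pos (by linarith)
    have G4 : 0 < Real.Gamma (1 + 2 * α) := Real.Gamma_pos_of_pos (by linarith)
    field_simp
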